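/- Let $X$ be an at most countable set and let $m\colon X\to(0,\infty)$, extended to a measure on $X$ by additivity, satisfy $m(X)<\infty$. A Dirichlet form on the complex Hilbert space $\ell^2(X,m)$ is a densely defined, closed, real quadratic form $Q$ with domain $D(Q)$ such that $C\circ u\in D(Q)$ and $Q(C\circ u)\le Q(u)$ for all $u\in D(Q)$ and all normal contractions $C$, i.e. all $C\colon\mathbb C\to\mathbb C$ with $C(0)=0$ and $|C(s)-C(t)|\le|s-t|$. Its generator is the positive self-adjoint operator $L$ with $D(L)\subseteq D(Q)$ and $Q(v,u)=\langle v,Lu\rangle$ for all $u\in D(L)$, $v\in D(Q)$; equivalently, $D(L^{1/2})=D(Q)$ and $Q(f)=\|L^{1/2}f\|_2^2$ for $f\in D(Q)$. Let $\alpha\ge 0$ and $o\in X$, and let $Q$ be a Dirichlet form on $\ell^2(X,m)$ that satisfies an $\ell^\infty_{\alpha,o}$-Sobolev inequality: there is a constant $S$ with $$\|u\|_\infty^2\le S\,\bigl(Q(u)+\alpha|u(o)|^2\bigr)\qquad\text{for all } u\in D(Q).$$ Let $S_{\infty,\alpha,o}(Q)$ be the minimal such $S$. Theorem. The spectrum of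 the generator $L$ of $Q$ is purely discrete, that is, it consists of isolated eigenvalues of finite multiplicity. Let $\lambda_1\le\lambda_2\le\cdots$ be the eigenvalues of $L$ in nondecreasing order, counted with multiplicity; there are $|X|$ of them if $X$ is finite and infinitely many otherwise. Then for every enumeration $x_1,x_2,\ldots$ of $X$ without repetition with $x_1=o$, and for every integer $k\ge 2$ (with $k\le|X|$ if $X$ is finite), $$\lambda_k\ \ge\ \frac{1}{S_{\infty,\alpha,o}(Q)\,m\bigl(X\setminus\{x_1,\ldots,x_{k-1}\}\bigr)}.$$ If $\alpha=0$, the same inequality also holds for $k=1$, that is, $\lambda_1\ge 1/\bigl(S_{\infty,0,o}(Q)\,m(X)\bigr)$. -/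

import Mathlib

open MeasureTheory Filter Topology
open scoped ENNReal

noncomputable section

/-! ### Closed quadratic forms and their generators -/

/-- A densely defined, closed, nonnegative quadratic form on a complex Hilbert space `H`, given by
its domain and the associated Hermitian sesquilinear form (conjugate linear in the first entry).
The quadratic form itself is `ClosedForm.Q`. -/
structure ClosedForm (H : Type*) [NormedAddCommGroup H] [InnerProductSpace ℂ H] where
  domain : Submodule ℂ H
  form : domain →ₗ⋆[ℂ] domain →ₗ[ℂ] ℂ
  conj_symm : ∀ u v : domain, starRingEnd ℂ (form u v) = form v u
  nonneg : ∀ u : domain, 0 ≤ (form u u).re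
  dense_domain : Dense (domain : Set H)
  closed : ∀ (u : ℕ → domain) (f : H), Tendsto (fun n => (u n : H)) atTop (𝓝 f) →
    (∀ ε : ℝ, 0 < ε → ∃ N : ℕ, ∀ i ≥ N, ∀ j ≥ N, (form (u i - u j) (u i - u j)).re < ε) →
    ∃ hf : f ∈ domain,
      Tendsto (fun n => (form (u n - ⟨f, hf⟩) (u n - ⟨f, hf⟩)).re) atTop (𝓝 0)

namespace ClosedForm

variable {H : Type*} [NormedAddCommGroup H] [InnerProductSpace ℂ H]

/-- The quadratic form `Q(u) = Q(u, u)`. -/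
def Q (q : ClosedForm H) (u : q.domain) : ℝ := (q.form u u).re

/-- The graph of the generator: all pairs `(u, w)` with `u ∈ D(Q)` and `Q(v, u) = ⟪v, w⟫` for all
`v ∈ D(Q)`. -/
def generatorGraph (q : ClosedForm H) : Submodule ℂ (H × H) where
  carrier := {p | ∃ hu : p.1 ∈ q.domain, ∀ v : q.domain,
    q.form v ⟨p.1, hu⟩ = inner ℂ (v : H) p.2}
  zero_mem' := ⟨q.domain.zero_mem, fun v => by
    have h : (⟨(0 : H × H).1, q.domain.zero_mem⟩ : q.domain) = 0 := rfl
    rw [h]; simp⟩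
  add_mem' := by
    rintro ⟨a, b⟩ ⟨c, d⟩ ⟨ha, hb⟩ ⟨hc, hd⟩
    refine ⟨q.domain.add_mem ha hc, fun v => ?_⟩
    have h : (⟨((a, b) + (c, d) : H × H).1, q.domain.add_mem ha hc⟩ : q.domain)
      = ⟨a, ha⟩ + ⟨c, hc⟩ := rfl
    rw [h, map_add, hb v, hd v]
    simp
  smul_mem' := by
    rintro z ⟨a, b⟩ ⟨ha, hb⟩
    refine ⟨q.domain.smul_mem z ha, fun v => ?_⟩
    have h : (⟨(z • (a, b) : H × H).1, q.domain.smul_mem z ha⟩ : q.domain)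
      = z • ⟨a, ha⟩ := rfl
    rw [h, map_smul, hb v]
    simp

/-- The generator `L` of the form: `D(L)` consists of all `u ∈ D(Q)` for which there is `w ∈ H` with
`Q(v, u) = ⟪v, w⟫` for all `v ∈ D(Q)`, and then `L u = w`. -/
def generator (q : ClosedForm H) : H →ₗ.[ℂ] H := q.generatorGraph.toLinearPMap

/-- The graph really is a graph, so the generator has the graph prescribed above. -/
theorem mem_graph_generator_iff (q : ClosedForm H) (u w : H) :
    (u, w) ∈ q.generator.graph ↔
      ∃ hu : u ∈ q.domain, ∀ v : q.domain, q.form v ⟨u, hu⟩ = inner ℂ (v : H) w := by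
  have key : ∀ x ∈ q.generatorGraph, x.1 = 0 → x.2 = 0 := by
    rintro ⟨a, b⟩ ⟨ha, hb⟩ h0
    obtain rfl : a = 0 := h0
    refine q.dense_domain.eq_zero_of_inner_right ℂ fun v hv => ?_
    have h := hb ⟨v, hv⟩
    have h' : (⟨((0 : H), b).1, ha⟩ : q.domain) = 0 := rfl
    rw [h', map_zero] at h
    exact h.symm
  rw [generator, Submodule.toLinearPMap_graph_eq _ key]
  rfl

end ClosedForm

/-! ### Spectral notions for unbounded operators -/

namespace LinearPMap

variable {H : Type*} [NormedAddCommGroup H] [InnerProductSpace ℂ H]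

/-- The spectrum of an unbounded operator: all `z` such that `L - z : D(L) → H` has no bounded
everywhere defined inverse. -/
def unboundedSpectrum (L : H →ₗ.[ℂ] H) : Set ℂ :=
  {z | ¬ ∃ R : H →L[ℂ] H,
      (∀ f : H, ∃ h : R f ∈ L.domain, L ⟨R f, h⟩ - z • R f = f) ∧
      (∀ u : L.domain, R (L u - z • (u : H)) = u)}

/-- The eigenspace `ker (L - z)`, a subspace of `D(L)`. -/
def eigenspaceAt (L : H →ₗ.[ℂ] H) (z : ℂ) : Submodule ℂ L.domain :=
  LinearMap.ker (L.toFun - z • L.domain.subtype)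

/-- The spectrum consists of isolated points only, and they are eigenvalues of finite
multiplicity. -/
def HasPurelyDiscreteSpectrum (L : H →ₗ.[ℂ] H) : Prop :=
  ∀ z ∈ L.unboundedSpectrum,
    (∃ ε : ℝ, 0 < ε ∧ ∀ w ∈ L.unboundedSpectrum, w ≠ z → ε ≤ ‖w - z‖) ∧
    L.eigenspaceAt z ≠ ⊥ ∧ FiniteDimensional ℂ (L.eigenspaceAt z)

/-- `ev` lists all eigenvalues of `L` in nondecreasing order, counted with multiplicity: each
`z ∈ ℂ` occurs exactly `dim ker (L - z)` times. -/
def IsEigenvalueSequence (L : H →ₗ.[ℂ] H) {ι : Type*} [Preorder ι] (ev : ι → ℝ) : Prop :=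
  Monotone ev ∧
    ∀ z : ℂ, {k | (ev k : ℂ) = z}.encard = Cardinal.toENat (Module.rank ℂ (L.eigenspaceAt z))

end LinearPMap

/-! ### Dirichlet forms on discrete measure spaces -/

/-- The measure on `X` obtained by additivity from the weights `m(x)`. -/
def discreteMeasure {X : Type*} [MeasurableSpace X] (m : X → ℝ) : Measure X :=
  Measure.sum fun x => ENNReal.ofReal (m x) • Measure.dirac x

/-- The complex Hilbert space `ℓ²(X, m)`. For positive weights on a countable set every point has
positive measure, so its elements have well-defined values at all points. -/
abbrev ellTwo {X : Type*} [MeasurableSpace X] (m : X → ℝ) : Type _ :=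
  Lp ℂ 2 (discreteMeasure m)

/-- A Dirichlet form on `ℓ²(X, m)`: a densely defined closed quadratic form that is compatible with
all normal contractions, that is, maps `C : ℂ → ℂ` with `C 0 = 0` and `|C s - C t| ≤ |s - t|`. -/
structure DirichletForm {X : Type*} [MeasurableSpace X] (m : X → ℝ)
    extends ClosedForm (ellTwo m) where
  markov : ∀ (C : ℂ → ℂ) (hC : LipschitzWith 1 C) (hC0 : C 0 = 0) (u : domain),
    ∃ h : hC.compLp hC0 (u : ellTwo m) ∈ domain,
      toClosedForm.Q ⟨hC.compLp hC0 (u : ellTwo m), h⟩ ≤ toClosedForm.Q u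

namespace DirichletForm

variable {X : Type*} [MeasurableSpace X] {m : X → ℝ}

/-- `‖u‖_p² ≤ S (Q(u) + α |u(o)|²)` for all `u ∈ D(Q)`. The norm on the left-hand side is
`∞` for `u ∉ ℓ^p(X, m)`. -/
def SobolevBound (q : DirichletForm m) (p : ℝ≥0∞) (α : ℝ) (o : X) (S : ℝ) : Prop :=
  ∀ u : q.domain, eLpNorm (u : ellTwo m) p (discreteMeasure m) ^ 2 ≤
    ENNReal.ofReal (S * (q.Q u + α * ‖(u : ellTwo m) o‖ ^ 2))

/-- The `ℓ^p_{α,o}`-Sobolev inequality. -/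
def SobolevInequality (q : DirichletForm m) (p : ℝ≥0∞) (α : ℝ) (o : X) : Prop :=
  ∃ S : ℝ, q.SobolevBound p α o S

/-- The `ℓ^p_{α,o}`-Sobolev constant `S_{p,α,o}(Q)`. -/
def sobolevConstant (q : DirichletForm m) (p : ℝ≥0∞) (α : ℝ) (o : X) : ℝ :=
  sInf {S : ℝ | q.SobolevBound p α o S}

end DirichletForm

/-- The index set `{1, …, |X|}` if `X` is finite, and `{1, 2, 3, …}` if `X` is infinite. -/
abbrev CountingIndex (X : Type*) : Type := {k : ℕ // 1 ≤ k ∧ (k : ℕ∞) ≤ ENat.card X}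

end

/-! Since `‖u(o)‖² ≤ m(o)⁻¹ ‖u‖²`, the Sobolev inequality embeds the form domain, with norm `(Q(u) +
‖u‖²)^(1/2)`, continuously into `ℓ^∞`. As `m(X) < ∞`, the complements of finite sets have small
mass, so the inclusion `J` of the form domain into `ℓ²(X, m)` is a norm limit of finite-rank
truncations, hence compact (`SobolevBound.isCompactOperator_inclusion`). Now `J J* = (L + 1)⁻¹` is
compact, symmetric and injective, and the spectral theorem yields a Hilbert basis of eigenvectors of
`L` (`exists_hilbertBasis`).

The lower bound is a dimension count (`SobolevBound.one_le_mul`). The span of `k` eigenvectors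
contains some `f ≠ 0` vanishing on `F = {x₁, …, x_{k-1}}`. Then `f(o) = 0`, and `‖f‖² ≤ m(X \ F)
‖f‖_∞² ≤ m(X \ F) S Q(f) ≤ m(X \ F) S λ_k ‖f‖²`. The same estimate with `m(X \ F)` small leaves only
finitely many eigenvalues below any level (`SobolevBound.finite_sublevel`), so they are isolated and
can be sorted. -/

namespace ClosedForm

/-! ### Form domain as a Hilbert space, and the resolvent of the generator. -/

variable {H : Type*} [NormedAddCommGroup H] [InnerProductSpace ℂ H]

/-- The domain of a closed form, to be equipped with the form norm. -/
def FormSpace (q : ClosedForm H) : Type _ := q.domain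

instance (q : ClosedForm H) : AddCommGroup q.FormSpace := inferInstanceAs (AddCommGroup q.domain)

instance (q : ClosedForm H) : Module ℂ q.FormSpace := inferInstanceAs (Module ℂ q.domain)

/-- The inner product `Q(u, v) + ⟪u, v⟫` on the form domain. -/
@[reducible]
noncomputable def formCore (q : ClosedForm H) : InnerProductSpace.Core ℂ q.FormSpace where
  inner u v := q.form u v + inner ℂ (Subtype.val u : H) (Subtype.val v)
  conj_inner_symm u v := by
    rw [map_add, inner_conj_symm]
    congr 1
    exact q.conj_symm v u
  re_inner_nonneg u := by
    have h1 := q.nonneg u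
    have h2 : 0 ≤ (inner ℂ (Subtype.val u : H) (Subtype.val u)).re := inner_self_nonneg (𝕜 := ℂ)
    change 0 ≤ (_ + _ : ℂ).re
    rw [Complex.add_re]
    exact add_nonneg h1 h2
  add_left u v w := by
    have h : (Subtype.val (u + v) : H) = Subtype.val u + Subtype.val v := rfl
    rw [h, inner_add_left]
    have h' : q.form (u + v) w = q.form u w + q.form v w := by
      have := congrArg (fun T => T w) (map_add q.form u v)
      exact this
    rw [h']
    ring
  smul_left u v r := by
    have h : (Subtype.val (r • u) : H) = r • Subtype.val u := rfl
    rw [h, inner_smul_left]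
    have h' : q.form (r • u) v = starRingEnd ℂ r * q.form u v := by
      have := congrArg (fun T => T v) (map_smulₛₗ q.form r u)
      exact this
    rw [h']
    ring
  definite u hu := by
    have h1 := q.nonneg u
    have h2 : (q.form u u).re + ‖(Subtype.val u : H)‖ ^ 2 = 0 := by
      have := congrArg Complex.re hu
      rw [Complex.add_re] at this
      rw [← inner_self_eq_norm_sq (𝕜 := ℂ)]
      exact this
    have h3 : ‖(Subtype.val u : H)‖ ^ 2 = 0 := by nlinarith [sq_nonneg ‖(Subtype.val u : H)‖]
    exact Subtype.ext (norm_eq_zero.1 (pow_eq_zero_iff two_ne_zero |>.1 h3))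

noncomputable instance (q : ClosedForm H) : NormedAddCommGroup q.FormSpace :=
  q.formCore.toNormedAddCommGroup

noncomputable instance (q : ClosedForm H) : InnerProductSpace ℂ q.FormSpace :=
  InnerProductSpace.ofCore q.formCore.toCore

theorem formSpace_inner (q : ClosedForm H) (u v : q.FormSpace) :
    inner ℂ u v = q.form u v + inner ℂ (Subtype.val u : H) (Subtype.val v) := rfl

theorem formSpace_norm_sq (q : ClosedForm H) (u : q.FormSpace) :
    ‖u‖ ^ 2 = q.Q u + ‖(Subtype.val u : H)‖ ^ 2 := by
  rw [← inner_self_eq_norm_sq (𝕜 := ℂ), ← inner_self_eq_norm_sq (𝕜 := ℂ), formSpace_inner, map_add]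
  rfl

theorem norm_val_le (q : ClosedForm H) (u : q.FormSpace) : ‖(Subtype.val u : H)‖ ≤ ‖u‖ := by
  have h := q.formSpace_norm_sq u
  have h1 : 0 ≤ q.Q u := q.nonneg u
  exact le_of_sq_le_sq (by linarith) (norm_nonneg _)

/-- The inclusion of the form domain, with the form norm, into the Hilbert space. -/
noncomputable def inclusion (q : ClosedForm H) : q.FormSpace →L[ℂ] H :=
  LinearMap.mkContinuous (show q.domain →ₗ[ℂ] H from q.domain.subtype : q.FormSpace →ₗ[ℂ] H) 1
    fun u => by
      rw [one_mul]
      exact q.norm_val_le u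

/-- This is what closedness of the form means: a Cauchy sequence for the form norm converges in `H`,
and `closed` upgrades this to convergence in the form norm. -/
instance [CompleteSpace H] (q : ClosedForm H) : CompleteSpace q.FormSpace := by
  refine Metric.complete_of_cauchySeq_tendsto fun u hu => ?_
  have hu' : CauchySeq fun n => q.inclusion (u n) :=
    hu.map q.inclusion.uniformContinuous
  obtain ⟨f, hf⟩ := cauchySeq_tendsto_of_complete hu'
  obtain ⟨hfd, hlim⟩ := q.closed u f hf fun ε hε => by
    obtain ⟨N, hN⟩ := Metric.cauchySeq_iff.1 hu (√ε) (Real.sqrt_pos.2 hε)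
    refine ⟨N, fun i hi j hj => ?_⟩
    have h1 := hN i hi j hj
    rw [dist_eq_norm] at h1
    have h2 := q.formSpace_norm_sq (u i - u j)
    have h3 : ‖u i - u j‖ ^ 2 < ε := by
      have := Real.lt_sqrt (norm_nonneg (u i - u j)) |>.1 h1
      exact this
    calc _ = q.Q (u i - u j) := rfl
      _ ≤ ‖u i - u j‖ ^ 2 := by rw [h2]; exact le_add_of_nonneg_right (sq_nonneg _)
      _ < ε := h3
  let g : q.FormSpace := ⟨f, hfd⟩
  refine ⟨g, ?_⟩
  rw [tendsto_iff_norm_sub_tendsto_zero]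
  have h1 : Tendsto (fun n => ‖u n - g‖ ^ 2) atTop (𝓝 0) := by
    have h2 := tendsto_iff_norm_sub_tendsto_zero.1 hf
    have h3 := hlim.add (h2.pow 2)
    rw [zero_pow two_ne_zero, add_zero] at h3
    refine h3.congr fun n => ?_
    exact (q.formSpace_norm_sq (u n - g)).symm
  have h2 := h1.sqrt
  simpa using h2

theorem nonneg_of_mem_graph (q : ClosedForm H) {u : H} {t : ℝ} (hu : u ≠ 0)
    (h : (u, (t : ℂ) • u) ∈ q.generator.graph) : 0 ≤ t := by
  obtain ⟨hd, hv⟩ := (q.mem_graph_generator_iff _ _).1 h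
  have h1 := hv ⟨u, hd⟩
  have h2 := q.nonneg ⟨u, hd⟩
  have h3 : inner ℂ u ((t : ℂ) • u) = ((t * ‖u‖ ^ 2 : ℝ) : ℂ) := by
    rw [inner_smul_right, inner_self_eq_norm_sq_to_K]
    push_cast
    rfl
  rw [h1, h3, Complex.ofReal_re] at h2
  have h4 : 0 < ‖u‖ ^ 2 := by positivity
  exact nonneg_of_mul_nonneg_left h2 h4

variable [CompleteSpace H]

/-- The resolvent `(L + 1)⁻¹` of the generator. -/
noncomputable def resolvent (q : ClosedForm H) : H →L[ℂ] H :=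
  q.inclusion ∘L ContinuousLinearMap.adjoint q.inclusion

theorem isSymmetric_resolvent (q : ClosedForm H) :
    (q.resolvent : H →ₗ[ℂ] H).IsSymmetric := by
  intro u v
  change inner ℂ (q.inclusion (ContinuousLinearMap.adjoint q.inclusion u)) v =
    inner ℂ u (q.inclusion (ContinuousLinearMap.adjoint q.inclusion v))
  rw [← ContinuousLinearMap.adjoint_inner_right, ContinuousLinearMap.adjoint_inner_left]

/-- With `w = J* f`, the adjoint relation reads `Q(v, w) + ⟪v, w⟫ = ⟪v, f⟫` for all `v`, that is, `L
w = f - w`. -/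
theorem resolvent_mem_graph (q : ClosedForm H) (f : H) :
    (q.resolvent f, f - q.resolvent f) ∈ q.generator.graph := by
  rw [mem_graph_generator_iff]
  let w : q.FormSpace := ContinuousLinearMap.adjoint q.inclusion f
  refine ⟨w.2, fun v => ?_⟩
  have h1 : inner ℂ (show q.FormSpace from v) w = inner ℂ (v : H) f :=
    ContinuousLinearMap.adjoint_inner_right q.inclusion (show q.FormSpace from v) f
  rw [formSpace_inner] at h1
  rw [inner_sub_right, eq_sub_iff_add_eq]
  exact h1

theorem resolvent_add_of_mem_graph (q : ClosedForm H) {u w : H}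
    (h : (u, w) ∈ q.generator.graph) : q.resolvent (u + w) = u := by
  obtain ⟨hu, hv⟩ := (q.mem_graph_generator_iff u w).1 h
  let u' : q.FormSpace := ⟨u, hu⟩
  have key : ContinuousLinearMap.adjoint q.inclusion (u + w) = u' := by
    refine ext_inner_left ℂ fun v => ?_
    rw [ContinuousLinearMap.adjoint_inner_right, formSpace_inner, inner_add_right, add_comm]
    congr 1
    exact (hv v).symm
  change q.inclusion (ContinuousLinearMap.adjoint q.inclusion (u + w)) = u
  rw [key]
  rfl

theorem resolvent_injective (q : ClosedForm H) : Function.Injective q.resolvent := by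
  rw [injective_iff_map_eq_zero]
  intro f hf
  have h := q.resolvent_mem_graph f
  rw [hf, sub_zero] at h
  exact q.generator.graph_fst_eq_zero_snd h rfl

theorem mem_graph_of_resolvent_eq_smul (q : ClosedForm H) {u : H} {z : ℂ} (hz : z ≠ 0)
    (h : q.resolvent u = z • u) : (u, (z⁻¹ - 1) • u) ∈ q.generator.graph := by
  have h1 := q.generator.graph.smul_mem z⁻¹ (q.resolvent_mem_graph u)
  rw [h] at h1
  convert h1 using 1
  ext
  · simp [smul_smul, hz]
  · simp [smul_sub, sub_smul, smul_smul, hz]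

/-- With `G = (L + 1)⁻¹` one has `L - z = (1 - (1 + z) G)(L + 1)`. By the Fredholm alternative the
first factor has a bounded inverse `B` unless `(1 + z)⁻¹` is an eigenvalue of `G`, which makes `z`
an eigenvalue of `L`. In the remaining case `B G` inverts `L - z`. -/
theorem unboundedSpectrum_subset (q : ClosedForm H) (hc : IsCompactOperator q.inclusion) {z : ℂ}
    (hz : z ∈ q.generator.unboundedSpectrum) :
    ∃ u : H, u ≠ 0 ∧ (u, z • u) ∈ q.generator.graph := by
  have hG : IsCompactOperator q.resolvent :=
    hc.comp_clm (ContinuousLinearMap.adjoint q.inclusion)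
  by_contra hcon
  push Not at hcon
  refine hz ?_
  have hunit : IsUnit (1 - (1 + z) • q.resolvent : H →L[ℂ] H) := by
    rcases eq_or_ne (1 + z) 0 with h0 | h0
    · simp [h0]
    rcases hG.hasEigenvalue_or_mem_resolventSet (inv_ne_zero h0) with h | h
    · obtain ⟨u, hu⟩ := h.exists_hasEigenvector
      refine absurd ?_ (hcon u hu.2)
      have := q.mem_graph_of_resolvent_eq_smul (inv_ne_zero h0) hu.apply_eq_smul
      simpa using this
    · rw [spectrum.mem_resolventSet_iff] at h
      have h2 := h.smul (Units.mk0 (1 + z) h0)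
      convert h2 using 1
      rw [Units.smul_mk0, smul_sub, Algebra.algebraMap_eq_smul_one, smul_smul,
        mul_inv_cancel₀ h0, one_smul]
  obtain ⟨A, hA⟩ := hunit
  set B : H →L[ℂ] H := ((A⁻¹ : (H →L[ℂ] H)ˣ) : H →L[ℂ] H) with hB
  have hcomm : ∀ f, B (q.resolvent f) = q.resolvent (B f) := by
    have h1 : Commute (A : H →L[ℂ] H) q.resolvent := by
      rw [hA]
      exact (Commute.one_left _).sub_left ((Commute.refl _).smul_left _)
    have h2 : Commute B q.resolvent := h1.units_inv_left
    exact fun f => congrArg (fun T : H →L[ℂ] H => T f) h2.eq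
  have hAB : ∀ f, B f - (1 + z) • q.resolvent (B f) = f := fun f => by
    have h1 : (A : H →L[ℂ] H) * B = 1 := A.mul_inv
    rw [hA] at h1
    exact congrArg (fun T : H →L[ℂ] H => T f) h1
  have hBA : ∀ f, B (f - (1 + z) • q.resolvent f) = f := fun f => by
    have h1 : B * (A : H →L[ℂ] H) = 1 := A.inv_mul
    rw [hA] at h1
    exact congrArg (fun T : H →L[ℂ] H => T f) h1
  refine ⟨B ∘L q.resolvent, fun f => ?_, fun u => ?_⟩
  · have h1 := q.resolvent_mem_graph (B f)
    rw [← hcomm] at h1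
    obtain ⟨y, hy1, hy2⟩ := (LinearPMap.mem_graph_iff _).1 h1
    have hmem : (B ∘L q.resolvent) f ∈ q.generator.domain := by
      have h2 := y.2
      rw [hy1] at h2
      exact h2
    refine ⟨hmem, ?_⟩
    have hy : (⟨(B ∘L q.resolvent) f, hmem⟩ : q.generator.domain) = y := Subtype.ext hy1.symm
    rw [hy, hy2]
    change B f - B (q.resolvent f) - z • B (q.resolvent f) = f
    rw [hcomm]
    refine Eq.trans ?_ (hAB f)
    module
  · have h1 := q.resolvent_add_of_mem_graph (q.generator.mem_graph u)
    change B (q.resolvent _) = _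
    set w := q.generator u
    refine Eq.trans ?_ (hBA (u : H))
    congr 1
    have h2 : w - z • (u : H) = ((u : H) + w) - (1 + z) • (u : H) := by module
    rw [h2, map_sub, h1, map_smul]

theorem exists_hilbertBasis (q : ClosedForm H) (hc : IsCompactOperator q.inclusion) :
    ∃ (ι : Type) (b : HilbertBasis ι ℂ H) (ev : ι → ℝ),
      ∀ i, 0 ≤ ev i ∧ (b i, (ev i : ℂ) • b i) ∈ q.generator.graph := by
  have hG : IsCompactOperator q.resolvent :=
    hc.comp_clm (ContinuousLinearMap.adjoint q.inclusion)
  have hsym := q.isSymmetric_resolvent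
  let T : Module.End ℂ H := (q.resolvent : H →ₗ[ℂ] H)
  -- Injectivity excludes the eigenvalue `0`, the only one whose eigenspace could be
  -- infinite-dimensional.
  have hT0 : ∀ {μ : ℂ}, T.HasEigenvalue μ → μ ≠ 0 := by
    rintro μ hμ rfl
    obtain ⟨u, hu⟩ := hμ.exists_hasEigenvector
    refine hu.2 (q.resolvent_injective ?_)
    have := hu.apply_eq_smul
    rw [zero_smul] at this
    rw [map_zero]
    exact this
  have hfin : ∀ μ : Module.End.Eigenvalues T, FiniteDimensional ℂ (T.eigenspace (μ : ℂ)) :=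
    fun μ => ContinuousLinearMap.finite_dimensional_eigenspace hG _ (hT0 μ.2)
  let v : (Σ μ : Module.End.Eigenvalues T, Fin (Module.finrank ℂ (T.eigenspace (μ : ℂ)))) → H :=
    fun a => (stdOrthonormalBasis ℂ (T.eigenspace (a.1 : ℂ)) a.2 : H)
  have hv : Orthonormal ℂ v :=
    (hsym.orthogonalFamily_eigenspaces').orthonormal_sigma_orthonormal
      fun μ => (stdOrthonormalBasis ℂ (T.eigenspace (μ : ℂ))).orthonormal
  have hspan : (Submodule.span ℂ (Set.range v))ᗮ = ⊥ := by
    rw [eq_bot_iff, ← ContinuousLinearMap.orthogonalComplement_iSup_eigenspaces_eq_bot hG hsym]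
    refine Submodule.orthogonal_le (iSup_le fun μ => ?_)
    by_cases hμ : T.HasEigenvalue μ
    · let μ' : Module.End.Eigenvalues T := ⟨μ, hμ⟩
      have h1 := (stdOrthonormalBasis ℂ (T.eigenspace (μ' : ℂ))).toBasis.span_eq
      have h2 := congrArg (Submodule.map (T.eigenspace (μ' : ℂ)).subtype) h1
      rw [Submodule.map_span, Submodule.map_top, Submodule.range_subtype] at h2
      change T.eigenspace (μ' : ℂ) ≤ _
      rw [← h2]
      refine Submodule.span_mono ?_
      rintro _ ⟨_, ⟨j, rfl⟩, rfl⟩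
      exact ⟨⟨μ', j⟩, by simp [v]⟩
    · rw [Module.End.hasEigenvalue_iff, not_not] at hμ
      change T.eigenspace μ ≤ _
      rw [hμ]
      exact bot_le
  let b := HilbertBasis.mkOfOrthogonalEqBot hv hspan
  have hb : ⇑b = v := HilbertBasis.coe_mkOfOrthogonalEqBot hv hspan
  have key : ∀ i, ∃ t : ℝ, 0 ≤ t ∧ (b i, (t : ℂ) • b i) ∈ q.generator.graph := by
    intro i
    have h1 : q.resolvent (b i) = (i.1 : ℂ) • b i := by
      rw [hb]
      exact Module.End.mem_eigenspace_iff.1 (stdOrthonormalBasis ℂ (T.eigenspace (i.1 : ℂ)) i.2).2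
    have hne : b i ≠ 0 := b.orthonormal.ne_zero i
    have h2 : (b i, ((i.1 : ℂ)⁻¹ - 1) • b i) ∈ q.generator.graph :=
      q.mem_graph_of_resolvent_eq_smul (hT0 i.1.2) h1
    have h3 : starRingEnd ℂ (i.1 : ℂ) = i.1 := hsym.conj_eigenvalue_eq_self i.1.2
    obtain ⟨r, hr⟩ := Complex.conj_eq_iff_real.1 h3
    -- An eigenvalue `r` of `(L + 1)⁻¹` is real by symmetry and corresponds to the eigenvalue `r⁻¹ -
    -- 1` of `L`.
    have h4 : ((i.1 : ℂ)⁻¹ - 1) = ((r⁻¹ - 1 : ℝ) : ℂ) := by rw [hr]; push_cast; rfl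
    rw [h4] at h2
    exact ⟨_, q.nonneg_of_mem_graph hne h2, h2⟩
  choose ev hev using key
  exact ⟨_, b, ev, hev⟩

end ClosedForm

/-! ### Sorting the eigenvalues and counting them. -/

/-- A real function with finite sublevel sets can be enumerated in nondecreasing order. -/
theorem exists_equiv_monotone_of_finite_sublevel {ι : Type*} (f : ι → ℝ)
    (hf : ∀ R, {i | f i ≤ R}.Finite) :
    ∃ e : {k : ℕ // 1 ≤ k ∧ (k : ℕ∞) ≤ ENat.card ι} ≃ ι, Monotone (f ∘ e) := by
  classical
  -- An arbitrary well-order breaks ties between equal values of `f`; the position of `i` is then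
  -- the size of its initial segment.
  obtain ⟨r, hr⟩ : ∃ r : ι → ι → Prop, IsWellOrder ι r := ⟨WellOrderingRel, inferInstance⟩
  let lt : ι → ι → Prop := fun i j => f i < f j ∨ (f i = f j ∧ r i j)
  have lt_trans' : ∀ {i j k}, lt i j → lt j k → lt i k := by
    rintro i j k (h1 | ⟨h1, h1'⟩) (h2 | ⟨h2, h2'⟩)
    · exact Or.inl (h1.trans h2)
    · exact Or.inl (h2 ▸ h1)
    · exact Or.inl (h1 ▸ h2)
    · exact Or.inr ⟨h1.trans h2, _root_.trans h1' h2'⟩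
  have lt_tri : ∀ i j, lt i j ∨ i = j ∨ lt j i := by
    intro i j
    rcases lt_trichotomy (f i) (f j) with h | h | h
    · exact Or.inl (Or.inl h)
    · rcases trichotomous_of r i j with h' | h' | h'
      · exact Or.inl (Or.inr ⟨h, h'⟩)
      · exact Or.inr (Or.inl h')
      · exact Or.inr (Or.inr (Or.inr ⟨h.symm, h'⟩))
    · exact Or.inr (Or.inr (Or.inl h))
  have lt_irr : ∀ i, ¬ lt i i := by
    rintro i (h | ⟨-, h⟩)
    · exact lt_irrefl _ h
    · exact irrefl_of r i h
  have lt_le : ∀ {i j}, lt i j → f i ≤ f j := by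
    rintro i j (h | h)
    · exact h.le
    · exact h.1.le
  -- The segment contains `i` itself, so ranks start at 1.
  let I : ι → Set ι := fun i => {j | lt j i ∨ j = i}
  have Ifin : ∀ i, (I i).Finite := fun i => (hf (f i)).subset (by
    rintro j (h | rfl)
    · exact lt_le h
    · exact le_refl (f j))
  let rank : ι → ℕ := fun i => (I i).ncard
  have self_mem : ∀ i, i ∈ I i := fun i => Or.inr rfl
  have rank_lt : ∀ {i j}, lt i j → rank i < rank j := by
    intro i j h
    refine Set.ncard_lt_ncard ⟨?_, fun hs => ?_⟩ (Ifin j)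
    · rintro k (hk | rfl)
      · exact Or.inl (lt_trans' hk h)
      · exact Or.inl h
    · rcases hs (self_mem j) with h' | h'
      · exact lt_irr _ (lt_trans' h h')
      · exact lt_irr _ (h' ▸ h)
  have rank_inj : Function.Injective rank := by
    intro i j hij
    rcases lt_tri i j with h | h | h
    · exact absurd hij (rank_lt h).ne
    · exact h
    · exact absurd hij (rank_lt h).ne'
  have rank_pos : ∀ i, 1 ≤ rank i := fun i =>
    (Set.ncard_pos (Ifin i)).2 ⟨i, self_mem i⟩
  have rank_le : ∀ i, (rank i : ℕ∞) ≤ ENat.card ι := fun i => by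
    rw [← (Ifin i).cast_ncard_eq.symm, ← Set.encard_univ]
    exact Set.encard_le_encard (Set.subset_univ _)
  have pred : ∀ i, 1 < rank i → ∃ j, rank j + 1 = rank i := by
    intro i hi
    have hne : (I i \ {i}).Nonempty := by
      rw [Set.nonempty_iff_ne_empty]
      intro h0
      have : I i ⊆ {i} := Set.sdiff_eq_empty.1 h0
      have := Set.ncard_le_ncard this
      rw [Set.ncard_singleton] at this
      exact absurd hi (not_lt.2 this)
    obtain ⟨j, hj, hmax⟩ := Set.exists_max_image _ rank ((Ifin i).sdiff (t := {i})) hne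
    refine ⟨j, ?_⟩
    have hji : lt j i := hj.1.resolve_right hj.2
    have : I i = insert i (I j) := by
      ext k
      constructor
      · intro hk
        by_cases hki : k = i
        · exact Or.inl hki
        · refine Or.inr ?_
          rcases lt_tri k j with h | h | h
          · exact Or.inl h
          · exact Or.inr h
          · exact absurd (rank_lt h) (not_lt.2 (hmax k ⟨hk, hki⟩))
      · rintro (rfl | hk | rfl)
        · exact self_mem _
        · exact Or.inl (lt_trans' hk hji)
        · exact Or.inl hji
    change _ = (I i).ncard
    rw [this, Set.ncard_insert_of_notMem _ (Ifin j)]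
    rintro (h | h)
    · exact lt_irr _ (lt_trans' h hji)
    · exact hj.2 h.symm
  -- Ranks have no gaps: descend from a larger rank one predecessor at a time.
  have down : ∀ n k, (∃ i, rank i = k + n) → 1 ≤ k → ∃ i, rank i = k := by
    intro n
    induction n with
    | zero => exact fun k h _ => h
    | succ n ih =>
      rintro k ⟨i, hi⟩ hk
      obtain ⟨j, hj⟩ := pred i (by omega)
      exact ih k ⟨j, by omega⟩ hk
  -- Otherwise `rank` would inject `ι` into `{1, …, k - 1}`.
  have large : ∀ k : ℕ, 1 ≤ k → (k : ℕ∞) ≤ ENat.card ι → ∃ i, k ≤ rank i := by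
    intro k hk hcard
    by_contra! hcon
    have hmaps : Set.MapsTo rank Set.univ (Set.Ico 1 k : Set ℕ) :=
      fun i _ => ⟨rank_pos i, hcon i⟩
    have h1 := Set.encard_le_encard_of_injOn hmaps rank_inj.injOn
    rw [Set.encard_univ, ← Finset.coe_Ico, Set.encard_coe_eq_coe_finsetCard, Nat.card_Ico] at h1
    have h2 := hcard.trans h1
    norm_cast at h2
    omega
  let φ : ι → {k : ℕ // 1 ≤ k ∧ (k : ℕ∞) ≤ ENat.card ι} := fun i => ⟨rank i, rank_pos i, rank_le i⟩
  have hφ : Function.Bijective φ := by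
    refine ⟨fun i j h => rank_inj (congrArg Subtype.val h), fun k => ?_⟩
    obtain ⟨i, hi⟩ := large k k.2.1 k.2.2
    obtain ⟨j, hj⟩ := down (rank i - k) k ⟨i, by omega⟩ k.2.1
    exact ⟨j, Subtype.ext hj⟩
  let e := Equiv.ofBijective φ hφ
  refine ⟨e.symm, fun k l hkl => ?_⟩
  obtain ⟨i, rfl⟩ := e.surjective k
  obtain ⟨j, rfl⟩ := e.surjective l
  simp only [Function.comp_apply, Equiv.symm_apply_apply]
  rcases lt_tri i j with h | h | h
  · exact lt_le h
  · rw [h]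
  · exact absurd (rank_lt h) (not_lt.2 hkl)

/-- `ENat.card` does not separate infinite cardinals, so only finite `κ` matters, where `c` is an
algebraic basis. Comparison with the basis of point indicators shows that there are `|X|`
eigenvalues. -/
theorem HilbertBasis.enatCard_le {ι κ H : Type*} [NormedAddCommGroup H] [InnerProductSpace ℂ H]
    (b : HilbertBasis ι ℂ H) (c : HilbertBasis κ ℂ H) : ENat.card ι ≤ ENat.card κ := by
  classical
  rcases finite_or_infinite κ with hκ | hκ
  · have := Fintype.ofFinite κ
    have : FiniteDimensional ℂ H := c.toOrthonormalBasis.toBasis.finiteDimensional_of_finite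
    have hli := b.orthonormal.linearIndependent
    have : Finite ι := hli.finite
    have := Fintype.ofFinite ι
    rw [ENat.card_eq_coe_fintype_card, ENat.card_eq_coe_fintype_card,
      ← Module.finrank_eq_card_basis c.toOrthonormalBasis.toBasis]
    exact_mod_cast hli.fintype_card_le_finrank
  · rw [ENat.card_eq_top_of_infinite (α := κ)]
    exact le_top

theorem HilbertBasis.enatCard_eq {ι κ H : Type*} [NormedAddCommGroup H] [InnerProductSpace ℂ H]
    (b : HilbertBasis ι ℂ H) (c : HilbertBasis κ ℂ H) : ENat.card ι = ENat.card κ :=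
  (b.enatCard_le c).antisymm (c.enatCard_le b)

/-! ### Eigenspaces, multiplicities and Rayleigh quotients from an eigenbasis. -/

namespace ClosedForm

variable {H : Type*} [NormedAddCommGroup H] [InnerProductSpace ℂ H]

theorem inner_eq_of_mem_graph (q : ClosedForm H) {u w u' w' : H}
    (h : (u, w) ∈ q.generator.graph) (h' : (u', w') ∈ q.generator.graph) :
    inner ℂ u w' = inner ℂ w u' := by
  obtain ⟨hu, hv⟩ := (q.mem_graph_generator_iff _ _).1 h
  obtain ⟨hu', hv'⟩ := (q.mem_graph_generator_iff _ _).1 h'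
  have h1 := hv' ⟨u, hu⟩
  have h2 := hv ⟨u', hu'⟩
  rw [← h1, ← q.conj_symm, h2, inner_conj_symm]

theorem inner_eq_zero_of_mem_graph (q : ClosedForm H) {e u : H} {t : ℝ} {z : ℂ}
    (he : (e, (t : ℂ) • e) ∈ q.generator.graph) (hu : (u, z • u) ∈ q.generator.graph)
    (hne : (t : ℂ) ≠ z) : inner ℂ e u = 0 := by
  have h := q.inner_eq_of_mem_graph he hu
  rw [inner_smul_right, inner_smul_left, Complex.conj_ofReal] at h
  have h1 : ((t : ℂ) - z) * inner ℂ e u = 0 := by rw [sub_mul, h, sub_self]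
  exact (mul_eq_zero.1 h1).resolve_left (sub_ne_zero.2 hne)

theorem mem_graph_of_mem_eigenspaceAt (q : ClosedForm H) {z : ℂ} {u : q.generator.domain}
    (hu : u ∈ q.generator.eigenspaceAt z) : ((u : H), z • (u : H)) ∈ q.generator.graph := by
  have h1 : q.generator u - z • (u : H) = 0 := hu
  rw [← sub_eq_zero.1 h1]
  exact q.generator.mem_graph u

theorem exists_mem_eigenspaceAt (q : ClosedForm H) {z : ℂ} {u : H}
    (hu : (u, z • u) ∈ q.generator.graph) :
    ∃ v : q.generator.eigenspaceAt z, ((v : q.generator.domain) : H) = u := by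
  obtain ⟨y, hy1, hy2⟩ := (LinearPMap.mem_graph_iff _).1 hu
  refine ⟨⟨y, ?_⟩, hy1⟩
  change q.generator y - z • (y : H) = 0
  rw [hy2, hy1, sub_self]

section Eigenbasis

variable {ι : Type*} (q : ClosedForm H) (b : HilbertBasis ι ℂ H) {ev : ι → ℝ}

theorem exists_eigenvalue_eq_of_mem_graph
    (hev : ∀ i, (b i, (ev i : ℂ) • b i) ∈ q.generator.graph) {z : ℂ} {u : H} (hu0 : u ≠ 0)
    (hu : (u, z • u) ∈ q.generator.graph) : ∃ i, (ev i : ℂ) = z := by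
  by_contra! hcon
  refine hu0 ?_
  have h1 := b.hasSum_repr u
  have h2 : (fun i => b.repr u i • b i) = fun _ => (0 : H) := by
    funext i
    rw [b.repr_apply_apply, q.inner_eq_zero_of_mem_graph (hev i) hu (hcon i), zero_smul]
  rw [h2] at h1
  exact h1.unique hasSum_zero

/-- An eigenvector for `z` is orthogonal to every `b i` with `ev i ≠ z`, so its Hilbert expansion is
a finite sum and the remaining `b i` form an algebraic basis. -/
theorem exists_basis_eigenspaceAt
    (hev : ∀ i, (b i, (ev i : ℂ) • b i) ∈ q.generator.graph) (z : ℂ)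
    (hfin : {i | (ev i : ℂ) = z}.Finite) :
    Nonempty (Module.Basis {i | (ev i : ℂ) = z} ℂ (q.generator.eigenspaceAt z)) := by
  have hmem : ∀ i : {i | (ev i : ℂ) = z}, (b i, z • b i) ∈ q.generator.graph := fun i => by
    have h := hev i
    rwa [show (ev i : ℂ) = z from i.2] at h
  choose g hg using fun i => q.exists_mem_eigenspaceAt (hmem i)
  let val : q.generator.eigenspaceAt z →ₗ[ℂ] H :=
    q.generator.domain.subtype ∘ₗ (q.generator.eigenspaceAt z).subtype
  have hval : Function.Injective val := Subtype.val_injective.comp Subtype.val_injective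
  have hli : LinearIndependent ℂ g := by
    refine LinearIndependent.of_comp val ?_
    have h1 : val ∘ g = b ∘ Subtype.val := funext hg
    rw [h1]
    exact b.orthonormal.linearIndependent.comp _ Subtype.val_injective
  refine ⟨Module.Basis.mk hli fun u _ => ?_⟩
  have hu : (val u, z • val u) ∈ q.generator.graph := q.mem_graph_of_mem_eigenspaceAt u.2
  have h1 := b.hasSum_repr (val u)
  have h2 := hasSum_sum_of_ne_finset_zero (L := .unconditional ι)
    (f := fun i => b.repr (val u) i • b i)
    (s := hfin.toFinset) fun i hi => by
      rw [b.repr_apply_apply, q.inner_eq_zero_of_mem_graph (hev i) hu, zero_smul]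
      simpa using hi
  have h3 := h1.unique h2
  have h4 : u = ∑ i ∈ hfin.toFinset.attach,
      b.repr (val u) i • g ⟨i, hfin.mem_toFinset.1 i.2⟩ := by
    apply hval
    refine h3.trans ?_
    rw [map_sum, ← Finset.sum_attach]
    refine Finset.sum_congr rfl fun i _ => ?_
    rw [map_smul]
    congr 1
    exact (hg ⟨i, hfin.mem_toFinset.1 i.2⟩).symm
  rw [h4]
  exact Submodule.sum_mem _ fun i _ => Submodule.smul_mem _ _ (Submodule.subset_span ⟨_, rfl⟩)

theorem finite_eigenvalue_eq (hfin : ∀ R, {i | ev i ≤ R}.Finite) (z : ℂ) :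
    {i | (ev i : ℂ) = z}.Finite :=
  (hfin z.re).subset fun i hi => by
    have h : (ev i : ℂ) = z := hi
    change ev i ≤ z.re
    rw [← h, Complex.ofReal_re]

theorem toENat_rank_eigenspaceAt
    (hev : ∀ i, (b i, (ev i : ℂ) • b i) ∈ q.generator.graph)
    (hfin : ∀ R, {i | ev i ≤ R}.Finite) (z : ℂ) :
    Cardinal.toENat (Module.rank ℂ (q.generator.eigenspaceAt z)) =
      {i | (ev i : ℂ) = z}.encard := by
  have hf := finite_eigenvalue_eq hfin z
  obtain ⟨B⟩ := q.exists_basis_eigenspaceAt b hev z hf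
  have : Finite {i | (ev i : ℂ) = z} := hf
  have := Fintype.ofFinite {i | (ev i : ℂ) = z}
  have : Module.Finite ℂ (q.generator.eigenspaceAt z) := .of_basis B
  rw [← Module.finrank_eq_rank, Module.finrank_eq_card_basis B, map_natCast, Set.encard,
    ENat.card_eq_coe_fintype_card]

theorem hasPurelyDiscreteSpectrum [CompleteSpace H] (hc : IsCompactOperator q.inclusion)
    (hev : ∀ i, (b i, (ev i : ℂ) • b i) ∈ q.generator.graph)
    (hfin : ∀ R, {i | ev i ≤ R}.Finite) : q.generator.HasPurelyDiscreteSpectrum := by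
  intro z hz
  obtain ⟨u, hu0, hu⟩ := q.unboundedSpectrum_subset hc hz
  refine ⟨?_, ?_, ?_⟩
  · obtain ⟨j, hj⟩ := q.exists_eigenvalue_eq_of_mem_graph b hev hu0 hu
    -- Eigenvalues above `ev j + 1` are at distance at least 1 from `z = ev j`; only finitely many
    -- others must be avoided.
    have hK : (((fun i => (ev i : ℂ)) '' {i | ev i ≤ ev j + 1}) \ {z}).Finite :=
      ((hfin _).image _).sdiff
    have hnhds := hK.isClosed.isOpen_compl.mem_nhds (x := z) fun h => h.2 rfl
    obtain ⟨ε, hε, hball⟩ := Metric.mem_nhds_iff.1 hnhds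
    refine ⟨min ε 1, lt_min hε one_pos, fun w hw hwz => ?_⟩
    obtain ⟨u', hu0', hu'⟩ := q.unboundedSpectrum_subset hc hw
    obtain ⟨i, hi⟩ := q.exists_eigenvalue_eq_of_mem_graph b hev hu0' hu'
    by_cases hle : ev i ≤ ev j + 1
    · refine (min_le_left _ _).trans ?_
      by_contra! hlt
      exact hball (mem_ball_iff_norm.2 hlt) ⟨⟨i, hle, hi⟩, hwz⟩
    · refine (min_le_right _ _).trans ?_
      rw [← hi, ← hj, ← Complex.ofReal_sub, Complex.norm_real]
      exact (by linarith : (1 : ℝ) ≤ ev i - ev j).trans (le_abs_self _)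
  · obtain ⟨v, hv⟩ := q.exists_mem_eigenspaceAt hu
    refine (Submodule.ne_bot_iff _).2 ⟨v, v.2, fun h => hu0 ?_⟩
    rw [← hv, h]
    rfl
  · have hf := finite_eigenvalue_eq hfin z
    obtain ⟨B⟩ := q.exists_basis_eigenspaceAt b hev z hf
    have : Finite {i | (ev i : ℂ) = z} := hf
    exact .of_basis B

theorem exists_Q_le_of_sum (hev : ∀ i, (b i, (ev i : ℂ) • b i) ∈ q.generator.graph)
    (A : Finset ι) {R : ℝ} (hR : ∀ i ∈ A, ev i ≤ R) (c : ι → ℂ) :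
    ∃ h : ∑ i ∈ A, c i • b i ∈ q.domain,
      q.Q ⟨∑ i ∈ A, c i • b i, h⟩ ≤ R * ‖∑ i ∈ A, c i • b i‖ ^ 2 := by
  have hsum : (∑ i ∈ A, c i • b i, ∑ i ∈ A, (c i * ev i) • b i) ∈ q.generator.graph := by
    have h1 : ∑ i ∈ A, c i • (b i, (ev i : ℂ) • b i) ∈ q.generator.graph :=
      Submodule.sum_mem _ fun i _ => Submodule.smul_mem _ _ (hev i)
    convert h1 using 1
    ext
    · rw [Prod.fst_sum]
      rfl
    · rw [Prod.snd_sum]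
      exact Finset.sum_congr rfl fun i _ => mul_smul _ _ _
  obtain ⟨hd, hv⟩ := (q.mem_graph_generator_iff _ _).1 hsum
  refine ⟨hd, ?_⟩
  have h1 : q.Q ⟨∑ i ∈ A, c i • b i, hd⟩ = ∑ i ∈ A, ‖c i‖ ^ 2 * ev i := by
    rw [Q, hv, b.orthonormal.inner_sum, Complex.re_sum]
    refine Finset.sum_congr rfl fun i _ => ?_
    rw [← mul_assoc, Complex.conj_mul']
    norm_cast
  have h2 : ‖∑ i ∈ A, c i • b i‖ ^ 2 = ∑ i ∈ A, ‖c i‖ ^ 2 := by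
    rw [← inner_self_eq_norm_sq (𝕜 := ℂ), b.orthonormal.inner_sum, map_sum]
    refine Finset.sum_congr rfl fun i _ => ?_
    rw [Complex.conj_mul']
    norm_cast
  rw [h1, h2, Finset.mul_sum]
  refine Finset.sum_le_sum fun i hi => ?_
  rw [mul_comm]
  exact mul_le_mul_of_nonneg_right (hR i hi) (sq_nonneg _)

end Eigenbasis

end ClosedForm

/-! ### Point evaluations in `ℓ²(X, m)`. -/

section DiscreteMeasure

variable {X : Type*} [Countable X] [MeasurableSpace X] [DiscreteMeasurableSpace X] {m : X → ℝ}

omit [Countable X] in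
theorem discreteMeasure_singleton (m : X → ℝ) (x : X) :
    discreteMeasure m {x} = ENNReal.ofReal (m x) := by
  rw [discreteMeasure, Measure.sum_apply _ (measurableSet_singleton x), tsum_eq_single x]
  · simp
  · intro y hy
    simp [hy]

omit [Countable X] in
theorem ae_discreteMeasure_iff (hm : ∀ x, 0 < m x) {p : X → Prop} :
    (∀ᵐ x ∂discreteMeasure m, p x) ↔ ∀ x, p x := by
  refine ⟨fun h x => ?_, fun h => Eventually.of_forall h⟩
  by_contra hx
  have h1 : discreteMeasure m {x} ≤ 0 := by
    rw [← ae_iff.1 h]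
    exact measure_mono (Set.singleton_subset_iff.2 hx)
  rw [discreteMeasure_singleton] at h1
  exact absurd (ENNReal.ofReal_eq_zero.1 (le_zero_iff.1 h1)) (not_le.2 (hm x))

variable [IsFiniteMeasure (discreteMeasure m)]

/-- The indicator function of a point, as an element of `ℓ²(X, m)`. -/
noncomputable def pointIndicator (m : X → ℝ) [IsFiniteMeasure (discreteMeasure m)] (x : X) :
    ellTwo m :=
  indicatorConstLp 2 (measurableSet_singleton x) (measure_ne_top (discreteMeasure m) {x}) (1 : ℂ)

theorem inner_pointIndicator (hm : ∀ x, 0 < m x) (x : X) (f : ellTwo m) :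
    inner ℂ (pointIndicator m x) f = (m x : ℂ) * f x := by
  rw [pointIndicator, L2.inner_indicatorConstLp_one, integral_singleton, Measure.real,
    discreteMeasure_singleton, ENNReal.toReal_ofReal (hm x).le]
  simp

/-- Turns vanishing at a point into orthogonality, so that Hilbert space arguments apply to
pointwise conditions. -/
theorem inner_pointIndicator_eq_zero_iff (hm : ∀ x, 0 < m x) {x : X} {f : ellTwo m} :
    inner ℂ (pointIndicator m x) f = 0 ↔ f x = 0 := by
  rw [inner_pointIndicator hm]
  simp [(hm x).ne']

theorem pointIndicator_apply (hm : ∀ x, 0 < m x) (x y : X) :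
    pointIndicator m x y = Set.indicator {x} (fun _ => (1 : ℂ)) y :=
  (ae_discreteMeasure_iff hm).1 indicatorConstLp_coeFn y

theorem norm_apply_sq_le (hm : ∀ x, 0 < m x) (x : X) (f : ellTwo m) :
    ‖f x‖ ^ 2 ≤ (m x)⁻¹ * ‖f‖ ^ 2 := by
  have h1 := norm_inner_le_norm (𝕜 := ℂ) (pointIndicator m x) f
  have h2 : ‖pointIndicator m x‖ ^ 2 = m x := by
    rw [← inner_self_eq_norm_sq (𝕜 := ℂ), inner_pointIndicator hm, pointIndicator_apply hm]
    simp
  rw [inner_pointIndicator hm, norm_mul, Complex.norm_real, Real.norm_of_nonneg (hm x).le] at h1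
  have h3 := pow_le_pow_left₀ (mul_nonneg (hm x).le (norm_nonneg _)) h1 2
  rw [mul_pow, mul_pow, h2, sq (m x), mul_assoc] at h3
  rw [← div_eq_inv_mul, le_div_iff₀' (hm x)]
  exact le_of_mul_le_mul_left h3 (hm x)

/-- The normalized point indicators form a Hilbert basis of `ℓ²(X, m)`. -/
theorem nonempty_hilbertBasis_ellTwo (hm : ∀ x, 0 < m x) :
    Nonempty (HilbertBasis X ℂ (ellTwo m)) := by
  have hne : ∀ x, pointIndicator m x ≠ 0 := fun x h => by
    have h1 := (inner_pointIndicator_eq_zero_iff hm).1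
      ((congrArg (inner ℂ (pointIndicator m x)) h).trans (inner_zero_right _))
    rw [pointIndicator_apply hm] at h1
    simp at h1
  let v : X → ellTwo m := fun x => ((‖pointIndicator m x‖ : ℂ)⁻¹) • pointIndicator m x
  have hv : Orthonormal ℂ v := by
    refine ⟨fun x => norm_smul_inv_norm (hne x), fun x y hxy => ?_⟩
    change inner ℂ (_ • _) (_ • _) = (0 : ℂ)
    rw [inner_smul_left, inner_smul_right,
      (inner_pointIndicator_eq_zero_iff hm).2 (by rw [pointIndicator_apply hm]; simp [hxy]),
      mul_zero, mul_zero]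
  refine ⟨HilbertBasis.mkOfOrthogonalEqBot hv ?_⟩
  rw [eq_bot_iff]
  intro f hf
  rw [Submodule.mem_orthogonal] at hf
  refine Lp.ext ?_
  have h1 : ∀ x, f x = 0 := fun x => by
    have h2 := hf (v x) (Submodule.subset_span ⟨x, rfl⟩)
    rw [inner_smul_left] at h2
    refine (inner_pointIndicator_eq_zero_iff hm).1 ((mul_eq_zero.1 h2).resolve_left ?_)
    simp [hne x]
  refine (ae_discreteMeasure_iff hm).2 fun x => ?_
  rw [h1, (ae_discreteMeasure_iff hm).1 (Lp.coeFn_zero ℂ 2 (discreteMeasure m)) x]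
  rfl

omit [Countable X] in
theorem norm_sq_le_of_bound_of_eq_zero (f : ellTwo m) (F : Set X) {K : ℝ}
    (h0 : ∀ x ∈ F, f x = 0) (hK : ∀ x ∉ F, ‖f x‖ ^ 2 ≤ K) :
    ‖f‖ ^ 2 ≤ (discreteMeasure m).real Fᶜ * K := by
  have h1 : ‖f‖ ^ 2 = ∫ x, ‖f x‖ ^ 2 ∂discreteMeasure m := by
    rw [← inner_self_eq_norm_sq (𝕜 := ℂ), L2.inner_def, ← integral_re]
    · simp_rw [inner_self_eq_norm_sq]
    · exact L2.integrable_inner f f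
  have h2 : ∫ x, ‖f x‖ ^ 2 ∂discreteMeasure m = ∫ x in Fᶜ, ‖f x‖ ^ 2 ∂discreteMeasure m := by
    refine (setIntegral_eq_integral_of_forall_compl_eq_zero fun x hx => ?_).symm
    rw [h0 x (not_not.1 hx)]
    simp
  have h3 : ∫ x in Fᶜ, ‖f x‖ ^ 2 ∂discreteMeasure m ≤
      ∫ _ in Fᶜ, K ∂discreteMeasure m := by
    refine setIntegral_mono_on ?_ ?_ (MeasurableSet.of_discrete) fun x hx => hK x hx
    · exact (Lp.memLp f).integrable_norm_pow two_ne_zero |>.integrableOn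
    · exact (integrable_const K).integrableOn
  rw [h1, h2]
  refine h3.trans_eq ?_
  simp

end DiscreteMeasure

/-! ### Consequences of the Sobolev inequality: compactness and the dimension count. -/

section DiscreteMeasure

variable {X : Type*} [Countable X] [MeasurableSpace X] [DiscreteMeasurableSpace X] {m : X → ℝ}
  [IsFiniteMeasure (discreteMeasure m)]

theorem tendsto_discreteMeasure_compl_atTop :
    Tendsto (fun F : Finset X => (discreteMeasure m).real (F : Set X)ᶜ) atTop (𝓝 0) := by
  have h1 : Tendsto (discreteMeasure m ∘ fun F : Finset X => (F : Set X)ᶜ) atTop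
      (𝓝 (discreteMeasure m (⋂ F : Finset X, (F : Set X)ᶜ))) :=
    tendsto_measure_iInter_atTop (fun _ => MeasurableSet.of_discrete.nullMeasurableSet)
      (fun F G hFG => Set.compl_subset_compl.2 (Finset.coe_subset.2 hFG))
      ⟨∅, measure_ne_top _ _⟩
  have h2 : (⋂ F : Finset X, (F : Set X)ᶜ) = ∅ := by
    refine Set.eq_empty_iff_forall_notMem.2 fun x hx => ?_
    exact Set.mem_iInter.1 hx {x} (by simp)
  rw [h2, measure_empty] at h1
  exact (ENNReal.tendsto_toReal ENNReal.zero_ne_top).comp h1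

namespace DirichletForm

variable {q : DirichletForm m} {α : ℝ} {o : X} {S : ℝ}

omit [Countable X] [IsFiniteMeasure (discreteMeasure m)] in
-- The maximum with `0` reflects the truncation in `ENNReal.ofReal`: the sign of `S` is not known at
-- this stage.
theorem SobolevBound.norm_apply_sq_le (hm : ∀ x, 0 < m x) (hS : q.SobolevBound ⊤ α o S)
    (u : q.domain) (x : X) :
    ‖(u : ellTwo m) x‖ ^ 2 ≤ max (S * (q.Q u + α * ‖(u : ellTwo m) o‖ ^ 2)) 0 := by
  have h1 : ‖(u : ellTwo m) x‖ₑ ≤ eLpNorm (u : ellTwo m) ⊤ (discreteMeasure m) := by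
    rw [eLpNorm_exponent_top]
    exact (ae_discreteMeasure_iff hm).1 ae_le_eLpNormEssSup x
  have h2 := (pow_le_pow_left₀ zero_le h1 2).trans (hS u)
  rw [← ofReal_norm, ← ENNReal.ofReal_pow (norm_nonneg _),
    ENNReal.ofReal_le_ofReal_iff'] at h2
  rcases h2 with h2 | h2
  · exact h2.trans (le_max_left _ _)
  · exact h2.trans (le_max_right _ _)

theorem SobolevBound.exists_norm_apply_sq_le (hm : ∀ x, 0 < m x) (hα : 0 ≤ α)
    (hS : q.SobolevBound ⊤ α o S) :
    ∃ C : ℝ, 0 ≤ C ∧ ∀ (u : q.toClosedForm.FormSpace) (x : X),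
      ‖q.toClosedForm.inclusion u x‖ ^ 2 ≤ C * ‖u‖ ^ 2 := by
  have hmo := inv_nonneg.2 (hm o).le
  -- The `1` accounts for `Q(u) ≤ ‖u‖²` in the form norm, the other term for `α ‖u(o)‖² ≤ α m(o)⁻¹
  -- ‖u‖²`.
  refine ⟨|S| * (1 + α * (m o)⁻¹), by positivity, fun u x => ?_⟩
  refine (hS.norm_apply_sq_le hm (show q.domain from u) x).trans ?_
  have h1 := _root_.norm_apply_sq_le hm o (q.toClosedForm.inclusion u)
  have h2 := q.toClosedForm.formSpace_norm_sq u
  have h3 : 0 ≤ q.Q u := q.nonneg u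
  have h4 := q.toClosedForm.norm_val_le u
  set t := ‖q.toClosedForm.inclusion u o‖ ^ 2 with ht
  have ht0 : 0 ≤ t := sq_nonneg _
  have h5 : ‖q.toClosedForm.inclusion u‖ ^ 2 ≤ ‖u‖ ^ 2 := pow_le_pow_left₀ (norm_nonneg _) h4 2
  have h6 : q.Q u ≤ ‖u‖ ^ 2 := h2 ▸ le_add_of_nonneg_right (sq_nonneg _)
  have h7 : α * t ≤ α * ((m o)⁻¹ * ‖u‖ ^ 2) :=
    mul_le_mul_of_nonneg_left (h1.trans (mul_le_mul_of_nonneg_left h5 hmo)) hα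
  have h8 : 0 ≤ q.Q u + α * t := by positivity
  refine max_le ?_ (by positivity)
  refine (mul_le_mul_of_nonneg_right (le_abs_self S) h8).trans ?_
  rw [mul_assoc]
  refine mul_le_mul_of_nonneg_left ?_ (abs_nonneg S)
  linarith

/-- Restriction to a finite set `F` is the orthogonal projection onto the span of the point
indicators of `F`. The error vanishes on `F` and is bounded pointwise by `√C ‖u‖`, so its operator
norm is at most `√(m(X \ F) C)`, which tends to `0`. -/
theorem SobolevBound.isCompactOperator_inclusion (hm : ∀ x, 0 < m x) (hα : 0 ≤ α)
    (hS : q.SobolevBound ⊤ α o S) : IsCompactOperator q.toClosedForm.inclusion := by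
  classical
  obtain ⟨C, hC0, hC⟩ := hS.exists_norm_apply_sq_le hm hα
  let K : Finset X → Submodule ℂ (ellTwo m) := fun F =>
    Submodule.span ℂ (F.image (pointIndicator m) : Set (ellTwo m))
  have hK : ∀ F, FiniteDimensional ℂ (K F) := fun F => FiniteDimensional.span_finset ℂ _
  have hzero : ∀ (F : Finset X), ∀ x ∉ F, ∀ f ∈ K F, f x = 0 := by
    intro F x hx f hf
    refine (inner_pointIndicator_eq_zero_iff hm).1 ?_
    have hle : K F ≤ (Submodule.span ℂ {pointIndicator m x})ᗮ := by
      refine Submodule.span_le.2 ?_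
      intro g hg
      obtain ⟨y, hy, rfl⟩ := Finset.mem_image.1 (Finset.mem_coe.1 hg)
      refine Submodule.mem_orthogonal_singleton_iff_inner_right.2
        ((inner_pointIndicator_eq_zero_iff hm).2 ?_)
      rw [pointIndicator_apply hm]
      exact Set.indicator_of_notMem (fun h => hx (by rwa [Set.mem_singleton_iff.1 h])) _
    exact Submodule.mem_orthogonal_singleton_iff_inner_right.1 (hle hf)
  let T : Finset X → q.toClosedForm.FormSpace →L[ℂ] ellTwo m := fun F =>
    (K F).starProjection ∘L q.toClosedForm.inclusion
  have hT : ∀ F, IsCompactOperator (T F) := fun F => by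
    have : ProperSpace (K F) := FiniteDimensional.proper ℂ (K F)
    have h1 : IsCompactOperator (K F).orthogonalProjectionOnto :=
      isCompactOperator_of_locallyCompactSpace_dom _
    exact (h1.clm_comp (K F).subtypeL).comp_clm q.toClosedForm.inclusion
  refine isCompactOperator_of_tendsto (F := T) (l := atTop) ?_ (Eventually.of_forall hT)
  rw [tendsto_iff_norm_sub_tendsto_zero]
  have hlim : Tendsto (fun F : Finset X => √((discreteMeasure m).real (F : Set X)ᶜ * C)) atTop
      (𝓝 0) := by
    simpa using (tendsto_discreteMeasure_compl_atTop (m := m)).mul_const C |>.sqrt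
  refine squeeze_zero (fun _ => norm_nonneg _) (fun F => ?_) hlim
  rw [norm_sub_rev]
  refine ContinuousLinearMap.opNorm_le_bound _ (Real.sqrt_nonneg _) fun u => ?_
  set f := q.toClosedForm.inclusion u with hf
  set p := (K F).starProjection f with hp
  have happ : ∀ x, (f - p) x = f x - p x := fun x =>
    (ae_discreteMeasure_iff hm).1 (Lp.coeFn_sub f p) x
  have hin : ∀ x ∈ (F : Set X), (f - p) x = 0 := fun x hx => by
    refine (inner_pointIndicator_eq_zero_iff hm).1 ?_
    refine Submodule.inner_right_of_mem_orthogonal (K := K F) (Submodule.subset_span ?_)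
      (Submodule.sub_starProjection_mem_orthogonal f)
    exact Finset.mem_coe.2 (Finset.mem_image_of_mem _ hx)
  have hout : ∀ x ∉ (F : Set X), ‖(f - p) x‖ ^ 2 ≤ C * ‖u‖ ^ 2 := fun x hx => by
    rw [happ, hzero F x hx p (Submodule.starProjection_apply_mem _ _), sub_zero]
    exact hC u x
  have h1 := norm_sq_le_of_bound_of_eq_zero (f - p) F hin hout
  change ‖f - p‖ ≤ _
  refine le_of_sq_le_sq (h1.trans_eq ?_) (by positivity)
  rw [mul_pow, Real.sq_sqrt (by positivity), mul_assoc]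

theorem SobolevBound.one_le_mul (hm : ∀ x, 0 < m x)
    (hS : q.SobolevBound ⊤ α o S) {ι : Type*} (b : HilbertBasis ι ℂ (ellTwo m)) {ev : ι → ℝ}
    (hev : ∀ i, (b i, (ev i : ℂ) • b i) ∈ q.generator.graph) {F : Finset X}
    (hF : o ∈ F ∨ α = 0) {A : Finset ι} (hcard : F.card < A.card) {R : ℝ}
    (hR : ∀ i ∈ A, ev i ≤ R) :
    0 < S ∧ 1 ≤ S * (discreteMeasure m).real (F : Set X)ᶜ * R := by
  classical
  -- Up to the weights `m x`, this evaluates a combination of the `b i` at the points of `F`; it has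
  -- more unknowns than equations.
  let Φ : (A → ℂ) →ₗ[ℂ] (F → ℂ) := LinearMap.pi fun x =>
    ∑ i : A, (inner ℂ (pointIndicator m x) (b i)) • LinearMap.proj i
  obtain ⟨c, hc, hc0⟩ := (Submodule.ne_bot_iff _).1
    (Φ.ker_ne_bot_of_finrank_lt (by simpa using hcard))
  let c' : ι → ℂ := fun i => if h : i ∈ A then c ⟨i, h⟩ else 0
  obtain ⟨hd, hQ⟩ := q.toClosedForm.exists_Q_le_of_sum b hev A hR c'
  set f := ∑ i ∈ A, c' i • b i with hf
  have hf0 : f ≠ 0 := by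
    intro h
    refine hc0 (funext fun i => ?_)
    have h1 := linearIndependent_iff'.1 b.orthonormal.linearIndependent A c' h i i.2
    simpa [c'] using h1
  have hfF : ∀ x ∈ F, f x = 0 := fun x hx => by
    refine (inner_pointIndicator_eq_zero_iff hm).1 ?_
    have h1 := congrFun (LinearMap.mem_ker.1 hc) ⟨x, hx⟩
    rw [hf, inner_sum, ← Finset.sum_attach]
    simp only [Φ, LinearMap.pi_apply, LinearMap.sum_apply, LinearMap.smul_apply,
      LinearMap.proj_apply, smul_eq_mul, Pi.zero_apply] at h1
    rw [← h1]
    refine Finset.sum_congr rfl fun i _ => ?_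
    rw [inner_smul_right, mul_comm]
    simp [c']
  -- The point term drops out because `f` vanishes at `o`, or because `α = 0`; in the latter case
  -- `F` may be empty, which gives `k = 1`.
  have hαo : α * ‖f o‖ ^ 2 = 0 := by
    rcases hF with h | h
    · rw [hfF o h]
      simp
    · rw [h, zero_mul]
  have hbound := norm_sq_le_of_bound_of_eq_zero f F hfF
    fun x _ => hS.norm_apply_sq_le hm ⟨f, hd⟩ x
  rw [hαo, add_zero] at hbound
  have hpos : 0 < ‖f‖ ^ 2 := by positivity
  have hQ0 : 0 ≤ q.Q ⟨f, hd⟩ := q.nonneg _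
  set M := (discreteMeasure m).real (F : Set X)ᶜ
  have hM : 0 ≤ M := measureReal_nonneg
  -- With `S ≤ 0` the Sobolev bound would force `f = 0`.
  have hSpos : 0 < S := by
    by_contra! h
    rw [max_eq_right (mul_nonpos_of_nonpos_of_nonneg h hQ0), mul_zero] at hbound
    exact absurd hbound (not_le.2 hpos)
  refine ⟨hSpos, ?_⟩
  rw [max_eq_left (mul_nonneg hSpos.le hQ0)] at hbound
  have h2 : M * (S * q.Q ⟨f, hd⟩) ≤ M * (S * (R * ‖f‖ ^ 2)) :=
    mul_le_mul_of_nonneg_left (mul_le_mul_of_nonneg_left hQ hSpos.le) hM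
  refine le_of_mul_le_mul_right ?_ hpos
  linarith

theorem SobolevBound.finite_sublevel (hm : ∀ x, 0 < m x)
    (hS : q.SobolevBound ⊤ α o S) {ι : Type*} (b : HilbertBasis ι ℂ (ellTwo m)) {ev : ι → ℝ}
    (hev : ∀ i, (b i, (ev i : ℂ) • b i) ∈ q.generator.graph) (R : ℝ) :
    {i | ev i ≤ R}.Finite := by
  have hlim : Tendsto (fun F : Finset X => S * (discreteMeasure m).real (F : Set X)ᶜ * R) atTop
      (𝓝 0) := by
    simpa using ((tendsto_discreteMeasure_compl_atTop (m := m)).const_mul S).mul_const R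
  -- `F` contains `o` and is so large that `S m(X \ F) R < 1`; hence at most `F.card` eigenvalues
  -- can be `≤ R`.
  obtain ⟨F, hF, hoF⟩ := ((hlim.eventually_lt_const one_pos).and (eventually_ge_atTop {o})).exists
  by_contra hinf
  obtain ⟨A, hA, hcard⟩ := Set.Infinite.exists_subset_card_eq hinf (F.card + 1)
  have h := hS.one_le_mul hm b hev (Or.inl (hoF (Finset.mem_singleton_self o)))
    (A := A) (by omega) (R := R) fun i hi => hA hi
  exact absurd h.2 (not_le.2 hF)

end DirichletForm

end DiscreteMeasure

theorem mainTheorem2 {X : Type*} [Countable X] [MeasurableSpace X] [DiscreteMeasurableSpace X]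
    (m : X → ℝ) (hm : ∀ x, 0 < m x) (hfin : discreteMeasure m Set.univ < ⊤)
    (q : DirichletForm m) (α : ℝ) (hα : 0 ≤ α) (o : X)
    (hS : q.SobolevInequality ⊤ α o) :
    q.generator.HasPurelyDiscreteSpectrum ∧
      ∃ ev : CountingIndex X → ℝ, q.generator.IsEigenvalueSequence ev ∧
        ∀ x : CountingIndex X ≃ X, (x.symm o : ℕ) = 1 →
          ∀ k : CountingIndex X, (2 ≤ (k : ℕ) ∨ α = 0) →
            1 / (q.sobolevConstant ⊤ α o * (discreteMeasure m).real (x '' {j | j < k})ᶜ)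
              ≤ ev k := by
  classical
  have : IsFiniteMeasure (discreteMeasure m) := ⟨hfin⟩
  obtain ⟨S, hS⟩ := hS
  have hcomp := hS.isCompactOperator_inclusion hm hα
  obtain ⟨ι, b, ev, hev⟩ := q.toClosedForm.exists_hilbertBasis hcomp
  replace hev := fun i => (hev i).2
  have hsub := hS.finite_sublevel hm b hev
  refine ⟨q.toClosedForm.hasPurelyDiscreteSpectrum b hcomp hev hsub, ?_⟩
  obtain ⟨c⟩ := nonempty_hilbertBasis_ellTwo (m := m) hm
  have hsort := exists_equiv_monotone_of_finite_sublevel ev hsub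
  rw [b.enatCard_eq c] at hsort
  obtain ⟨e, he⟩ := hsort
  refine ⟨ev ∘ e, ⟨he, fun z => ?_⟩, fun x hx k hk => ?_⟩
  · rw [q.toClosedForm.toENat_rank_eigenspaceAt b hev hsub z]
    exact Set.encard_preimage_of_bijective e.bijective {i | (ev i : ℂ) = z}
  have hlt : {j : CountingIndex X | j < k}.Finite :=
    (Set.finite_Iio (k : ℕ)).preimage Subtype.val_injective.injOn
  let I := hlt.toFinset
  have hI : ∀ j, j ∈ I ↔ j < k := fun j => hlt.mem_toFinset
  let F : Finset X := I.map x.toEmbedding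
  -- `F` consists of the first `k - 1` points, while `A` includes the index `k` and so has one
  -- element more.
  let A : Finset ι := (insert k I).map e.toEmbedding
  have hFset : x '' {j | j < k} = (F : Set X) := by
    rw [Finset.coe_map, hlt.coe_toFinset]
    rfl
  have hoF : o ∈ F ∨ α = 0 := by
    refine hk.imp_left fun h2 => ?_
    refine Finset.mem_map.2 ⟨x.symm o, (hI _).2 ?_, x.apply_symm_apply o⟩
    rw [← Subtype.coe_lt_coe, hx]
    omega
  have hcard : F.card < A.card := by
    rw [Finset.card_map, Finset.card_map, Finset.card_insert_of_notMem fun h =>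
      lt_irrefl k ((hI k).1 h)]
    exact Nat.lt_succ_self _
  have hA : ∀ i ∈ A, ev i ≤ (ev ∘ e) k := by
    intro i hi
    obtain ⟨j, hj, rfl⟩ := Finset.mem_map.1 hi
    refine he ?_
    rcases Finset.mem_insert.1 hj with rfl | hj
    · exact le_rfl
    · exact ((hI j).1 hj).le
  have key : ∀ {S'}, q.SobolevBound ⊤ α o S' →
      0 < S' ∧ 1 ≤ S' * (discreteMeasure m).real (F : Set X)ᶜ * (ev ∘ e) k := fun h =>
    h.one_le_mul hm b hev hoF hcard hA
  rw [hFset]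
  set M := (discreteMeasure m).real (F : Set X)ᶜ
  set t := (ev ∘ e) k
  have hMt : 0 < M * t := by
    obtain ⟨h1, h2⟩ := key hS
    rw [mul_assoc] at h2
    exact pos_of_mul_pos_right (one_pos.trans_le h2) h1.le
  have hM : 0 < M := (measureReal_nonneg).lt_of_ne' fun h => by
    have h' : M = 0 := h
    rw [h', zero_mul] at hMt
    exact lt_irrefl _ hMt
  -- The estimate holds for every admissible constant, hence for the infimum, whether or not it is
  -- attained.
  have hle : 1 / (M * t) ≤ q.sobolevConstant ⊤ α o := by
    refine le_csInf ⟨S, hS⟩ fun S' hS' => ?_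
    rw [div_le_iff₀ hMt, ← mul_assoc]
    exact (key hS').2
  have hpos : 0 < q.sobolevConstant ⊤ α o := (one_div_pos.2 hMt).trans_le hle
  rw [div_le_iff₀ hMt] at hle
  rw [div_le_iff₀ (mul_pos hpos hM)]
  linarith
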